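/- **Conventions.** A semiflow $(T,X)$ consists of a topological semigroup $T$ with neutral element $e$ (multiplication jointly continuous) and a jointly continuous action $T\times X\to X$, $(t,x)\mapsto tx$, with $ex=x$ and $(ts)x=t(sx)$. Here $X$ is a compact metric space with metric $d$. The semiflow is * *point transitive* if some $x\in X$ has a dense orbit $Tx$; * *equicontinuous* if for every $\varepsilon>0$ there is $\delta>0$ such that $d(x,y)<\delta$ implies $d(tx,ty)<\varepsilon$ for all $t\in T$; * *uniformly almost periodic* if for every $\varepsilon>0$ there is a syndetic set $A\subseteq T$ with $d(x,ax)<\varepsilon$ for all $a\in A$, $x\in X$, where $A\subseteq T$ is *syndetic* if there is a compact $K\subseteq T$ with $Kt\cap A\neq\emptyset$ for all $t\in T$. $\mathrm{Aut}(T,X)$ is the group of all self-homeomorphisms $a$ of $X$ with $a(tx)=t\,a(x)$ for all $t\in T$, $x\in X$. It is equicontinuous if for every $\varepsilon>0$ there is $\delta>0$ such that $d(x,y)<\delta$ implies $d(ax,ay)<\varepsilon$ for all $a\in\mathrm{Aut}(T,X)$. The semiflow is *universally transitive* if $\mathrm{Aut}(T,X)\,x=X$ for some $x\in X$. **Theorem.**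 Let $(T,X)$ be a point transitive semiflow on a compact metric space with $T$ abelian. Then the following are pairwise equivalent: 1. $(T,X)$ is universally transitive. 2. $\mathrm{Aut}(T,X)$ is equicontinuous and each $t\in T$ acts as a self-homeomorphism of $X$. 3. $(T,X)$ is equicontinuous and each $t\in T$ acts as a surjection of $X$ onto $X$. 4. $(T,X)$ is uniformly almost periodic. Moreover, the implications $(1)\Rightarrow(4)\Rightarrow(3)\Rightarrow(2)$ hold for every point transitive semiflow on a compact metric space, without assuming that $T$ is abelian, whereas $(2)\Rightarrow(1)$ can fail for point transitive semiflows on compact metric spaces when $T$ is not abelian. -/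

import Mathlib

open scoped Uniformity

namespace Semiflow

/-- A subset `A` of a topological monoid `T` is syndetic if there is a compact `K ⊆ T` with
`K t ∩ A ≠ ∅` for every `t`. -/
def IsSyndetic {T : Type*} [Monoid T] [TopologicalSpace T] (A : Set T) : Prop :=
  ∃ K : Set T, IsCompact K ∧ ∀ t : T, ∃ k ∈ K, k * t ∈ A

/-- Some point has a dense orbit. -/
def PointTransitive (T X : Type*) [Monoid T] [TopologicalSpace X] [MulAction T X] : Prop :=
  ∃ x : X, closure (MulAction.orbit T x) = Set.univ

/-- Uniform equicontinuity of the family of maps `x ↦ t • x`, `t ∈ T`. -/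
def Equicontinuous (T X : Type*) [Monoid T] [UniformSpace X] [MulAction T X] : Prop :=
  ∀ ε ∈ 𝓤 X, ∃ δ ∈ 𝓤 X, ∀ x y : X, (x, y) ∈ δ → ∀ t : T, (t • x, t • y) ∈ ε

/-- For every entourage `ε` there is a syndetic `A ⊆ T` with `A x ⊆ ε[x]` for all `x`. -/
def UniformlyAlmostPeriodic (T X : Type*) [Monoid T] [TopologicalSpace T] [UniformSpace X]
    [MulAction T X] : Prop :=
  ∀ ε ∈ 𝓤 X, ∃ A : Set T, IsSyndetic A ∧ ∀ a ∈ A, ∀ x : X, (x, a • x) ∈ ε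

/-- The automorphism group: all self-homeomorphisms of `X` that commute with the action of
every `t ∈ T`. -/
def Aut (T X : Type*) [Monoid T] [TopologicalSpace X] [MulAction T X] : Subgroup (X ≃ₜ X) where
  carrier := {a | ∀ (t : T) (x : X), a (t • x) = t • a x}
  one_mem' := fun _ _ => rfl
  mul_mem' := fun {a b} ha hb t x => by
    change a (b (t • x)) = t • a (b x)
    rw [hb, ha]
  inv_mem' := fun {a} ha t x => by
    change a.symm (t • x) = t • a.symm x
    rw [Homeomorph.symm_apply_eq, ha, Homeomorph.apply_symm_apply]

/-- `Aut(T, X) x = X` for some point `x`. -/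
def UniversallyTransitive (T X : Type*) [Monoid T] [TopologicalSpace X] [MulAction T X] : Prop :=
  ∃ x : X, ∀ y : X, ∃ a ∈ Aut T X, a x = y

/-- Uniform equicontinuity of the family of maps `Aut(T, X)`. -/
def AutEquicontinuous (T X : Type*) [Monoid T] [UniformSpace X] [MulAction T X] : Prop :=
  ∀ ε ∈ 𝓤 X, ∃ δ ∈ 𝓤 X, ∀ x y : X, (x, y) ∈ δ → ∀ a ∈ Aut T X, (a x, a y) ∈ ε

/-- Every `t ∈ T` acts as a self-homeomorphism of `X`. -/
def ActsByHomeomorphisms (T X : Type*) [Monoid T] [TopologicalSpace X] [MulAction T X] : Prop :=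
  ∀ t : T, IsHomeomorph (fun x : X => t • x)

/-- Every `t ∈ T` acts as a surjection of `X` onto itself. -/
def ActsBySurjections (T X : Type*) [Monoid T] [MulAction T X] : Prop :=
  ∀ t : T, Function.Surjective (fun x : X => t • x)

end Semiflow

open Topology Filter

namespace Semiflow

/-! ### Metric reformulations and rigidity of commuting maps -/

section Metric

variable {T X : Type*} [Monoid T] [MetricSpace X] [MulAction T X]

/-! A continuous map commuting with `T` is determined by its value at a point `z` with dense orbit
(`eq_of_commuting`). (4) ⇒ (3): every `t` is uniformly close to an element of one compact `K ⊆ T`,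
and `K` acts equicontinuously; `t` also has approximate right inverses. Injectivity under (3) comes
from recurrence of the powers of `t`. (3) ⇒ (2): the closure of `T` in `C(X, X)` is compact and
commutes with automorphisms, so closeness at `z` controls closeness along the closure of `Aut(T, X)
z`. (2) ⇒ (1): for abelian `T` the translations are automorphisms; compactness turns the dense orbit
of `z` into a full `Aut(T, X)`-orbit. (1) ⇒ (4) is the deep step. Every `y` is `φ y z` for a unique
automorphism `φ y`. Evaluation at `z` is a continuous bijection from a Polish space of maps onto
`X`; an open mapping argument with Baire category (`exists_dist_lt_of_transitive`) makes its inverse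
continuous, so `Aut(T, X)` is equicontinuous. Moving `z` by all `φ x` then shows that any `t` nearly
fixing `z` is uniformly near the identity. -/

theorem equicontinuous_iff_dist : Equicontinuous T X ↔
    ∀ ε > 0, ∃ δ > 0, ∀ x y : X, dist x y < δ → ∀ t : T, dist (t • x) (t • y) < ε := by
  constructor
  · intro h ε hε
    obtain ⟨U, hU, h⟩ := h _ (Metric.dist_mem_uniformity hε)
    obtain ⟨δ, hδ, hd⟩ := Metric.mem_uniformity_dist.1 hU
    exact ⟨δ, hδ, fun x y hxy t => h x y (hd hxy) t⟩
  · intro h U hU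
    obtain ⟨ε, hε, hd⟩ := Metric.mem_uniformity_dist.1 hU
    obtain ⟨δ, hδ, h⟩ := h ε hε
    exact ⟨_, Metric.dist_mem_uniformity hδ, fun x y hxy t => hd (h x y hxy t)⟩

theorem autEquicontinuous_iff_dist : AutEquicontinuous T X ↔
    ∀ ε > 0, ∃ δ > 0, ∀ x y : X, dist x y < δ → ∀ a ∈ Aut T X, dist (a x) (a y) < ε := by
  constructor
  · intro h ε hε
    obtain ⟨U, hU, h⟩ := h _ (Metric.dist_mem_uniformity hε)
    obtain ⟨δ, hδ, hd⟩ := Metric.mem_uniformity_dist.1 hU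
    exact ⟨δ, hδ, fun x y hxy t => h x y (hd hxy) t⟩
  · intro h U hU
    obtain ⟨ε, hε, hd⟩ := Metric.mem_uniformity_dist.1 hU
    obtain ⟨δ, hδ, h⟩ := h ε hε
    exact ⟨_, Metric.dist_mem_uniformity hδ, fun x y hxy t ht => hd (h x y hxy t ht)⟩

theorem uniformlyAlmostPeriodic_iff_dist [TopologicalSpace T] : UniformlyAlmostPeriodic T X ↔
    ∀ ε > 0, ∃ A : Set T, IsSyndetic A ∧ ∀ a ∈ A, ∀ x : X, dist x (a • x) < ε := by
  constructor
  · intro h ε hε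
    exact h _ (Metric.dist_mem_uniformity hε)
  · intro h U hU
    obtain ⟨ε, hε, hd⟩ := Metric.mem_uniformity_dist.1 hU
    obtain ⟨A, hA, h⟩ := h ε hε
    exact ⟨A, hA, fun a ha x => hd (h a ha x)⟩

/-- Two commuting maps that agree at a point with dense orbit are equal. -/
theorem eq_of_commuting {z : X} (hz : Dense (MulAction.orbit T z)) {f g : X → X}
    (hf : Continuous f) (hg : Continuous g) (hfT : ∀ (t : T) x, f (t • x) = t • f x)
    (hgT : ∀ (t : T) x, g (t • x) = t • g x) (h : f z = g z) : f = g := by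
  refine hf.ext_on hz hg ?_
  rintro _ ⟨t, rfl⟩
  simp only [hfT, hgT, h]

/-- Automorphisms mapping a point with dense orbit to every point of a universally transitive
semiflow. -/
theorem UniversallyTransitive.exists_family (hpt : PointTransitive T X)
    (h : UniversallyTransitive T X) : ∃ (z : X) (φ : X → X ≃ₜ X),
      Dense (MulAction.orbit T z) ∧ (∀ y, φ y ∈ Aut T X) ∧ ∀ y, φ y z = y := by
  obtain ⟨z, hz⟩ := hpt
  obtain ⟨x, hx⟩ := h
  choose a ha hax using hx
  refine ⟨z, fun y => a y * (a z)⁻¹, dense_iff_closure_eq.2 hz,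
    fun y => mul_mem (ha y) (inv_mem (ha z)), fun y => ?_⟩
  change a y ((a z).symm z) = y
  rw [(a z).symm_apply_eq.2 (hax z).symm, hax]

end Metric

/-- A form of the Arzelà–Ascoli theorem for self-maps of a compact metric space. -/
theorem isCompact_closure_of_equicontinuous {X : Type*} [MetricSpace X] [CompactSpace X]
    (S : Set C(X, X))
    (h : ∀ ε > 0, ∃ δ > 0, ∀ x y : X, dist x y < δ → ∀ f ∈ S, dist (f x) (f y) < ε) :
    IsCompact (closure S) := by
  have hc : IsCompact (closure ((ContinuousMap.isometryEquivBoundedOfCompact X X) '' S)) := by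
    refine BoundedContinuousFunction.arzela_ascoli Set.univ isCompact_univ _
      (fun _ _ _ => trivial) ?_
    intro x
    rw [Metric.equicontinuousAt_iff]
    intro ε hε
    obtain ⟨δ, hδ, h⟩ := h ε hε
    refine ⟨δ, hδ, ?_⟩
    rintro y hy ⟨_, f, hf, rfl⟩
    rw [dist_comm] at hy
    exact h x y hy f hf
  rw [show closure ((ContinuousMap.isometryEquivBoundedOfCompact X X) '' S)
    = (ContinuousMap.isometryEquivBoundedOfCompact X X).toHomeomorph '' closure S from
    ((ContinuousMap.isometryEquivBoundedOfCompact X X).toHomeomorph.image_closure S).symm] at hc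
  exact (Homeomorph.isCompact_image _).1 hc

section Compact

variable {T X : Type*} [Monoid T] [TopologicalSpace T] [MetricSpace X]
  [MulAction T X] [ContinuousSMul T X]

/-- The action of `t` as a continuous map. -/
def smulMap (X : Type*) [TopologicalSpace X] [MulAction T X] [ContinuousSMul T X] (t : T) :
    C(X, X) := ⟨fun x => t • x, continuous_const_smul t⟩

/-- The continuous self-maps of `X` commuting with the action of `T`. -/
def commutingMaps (T X : Type*) [Monoid T] [TopologicalSpace X] [MulAction T X] : Set C(X, X) :=
  {f | ∀ (t : T) (x : X), f (t • x) = t • f x}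

theorem isClosed_commutingMaps : IsClosed (commutingMaps T X) := by
  simp only [commutingMaps, Set.ofPred_forall]
  refine isClosed_iInter fun t => isClosed_iInter fun x => isClosed_eq ?_ ?_
  · exact ContinuousEvalConst.continuous_eval_const _
  · exact (ContinuousEvalConst.continuous_eval_const x).const_smul t


/-! ### Uniform almost periodicity implies equicontinuity and surjectivity -/

variable [CompactSpace X]

/-- Choose `l` with `l * t` almost the identity, then `k` in a fixed compact `K` with `k * l` almost
the identity. Comparing `k • l • t • x` with both `t • x` and `k • x` gives `t ≈ k`, hence `t * l ≈
k * l ≈ 1`. Compactness of `K` makes `δ` independent of `t`. -/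
theorem UniformlyAlmostPeriodic.exists_approximation (h : UniformlyAlmostPeriodic T X)
    {ε : ℝ} (hε : 0 < ε) : ∃ δ > 0, ∀ t : T, ∃ k : T,
      (∀ x : X, dist (t • x) (k • x) < ε) ∧ (∃ s : T, ∀ x : X, dist (t • s • x) x < ε) ∧
      ∀ x y : X, dist x y < δ → dist (k • x) (k • y) < ε := by
  rw [uniformlyAlmostPeriodic_iff_dist] at h
  obtain ⟨A, ⟨K, hK, hKA⟩, hA⟩ := h (ε / 3) (by positivity)
  -- A tube-lemma argument over `K` at each diagonal point; on compact `X` the neighbourhoods of the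
  -- diagonal are the entourages.
  have huc : ∃ δ > 0, ∀ x y : X, dist x y < δ → ∀ k ∈ K, dist (k • x) (k • y) < ε / 3 := by
    let V : Set (X × X) := {q | ∀ k ∈ K, dist (k • q.1) (k • q.2) < ε / 3}
    have hV : ∀ x : X, V ∈ 𝓝 (x, x) := by
      intro x
      refine hK.eventually_forall_of_forall_eventually (x₀ := (x, x))
        (P := fun q k => dist (k • q.1) (k • q.2) < ε / 3) fun k _ => ?_
      have hcont : Continuous fun z : (X × X) × T => dist (z.2 • z.1.1) (z.2 • z.1.2) := by
        fun_prop
      have := hcont.isOpen_preimage _ (isOpen_Iio (a := ε / 3))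
      exact this.mem_nhds (by simpa using by positivity)
    have hVu : V ∈ 𝓤 X := by
      rw [← nhdsSet_diagonal_eq_uniformity]
      rw [mem_nhdsSet_iff_forall]
      rintro ⟨x, y⟩ hxy
      obtain rfl : x = y := hxy
      exact hV x
    obtain ⟨δ, hδ, hd⟩ := Metric.mem_uniformity_dist.1 hVu
    exact ⟨δ, hδ, fun x y hxy => hd hxy⟩
  obtain ⟨δ, hδ, huc⟩ := huc
  obtain ⟨B, ⟨L, -, hLB⟩, hB⟩ := h δ hδ
  refine ⟨δ, hδ, fun t => ?_⟩
  obtain ⟨l, -, hl⟩ := hLB t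
  obtain ⟨k, hk, hkl⟩ := hKA l
  have key : ∀ x : X, dist (t • x) (k • x) < 2 * (ε / 3) := by
    intro x
    have h1 := hA _ hkl (t • x)
    have h2 := huc _ _ (hB _ hl x) k hk
    rw [mul_smul] at h1 h2
    rw [dist_comm] at h2
    linarith [dist_triangle (t • x) (k • l • t • x) (k • x)]
  refine ⟨k, fun x => by linarith [key x], ⟨l, fun x => ?_⟩, fun x y hxy => ?_⟩
  · have h1 := hA _ hkl x
    rw [mul_smul, dist_comm] at h1
    linarith [key (l • x), dist_triangle (t • l • x) (k • l • x) x]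
  · linarith [huc x y hxy k hk]

theorem UniformlyAlmostPeriodic.equicontinuous (h : UniformlyAlmostPeriodic T X) :
    Equicontinuous T X := by
  rw [equicontinuous_iff_dist]
  intro ε hε
  obtain ⟨δ, hδ, hk⟩ := h.exists_approximation (ε := ε / 3) (by positivity)
  refine ⟨δ, hδ, fun x y hxy t => ?_⟩
  obtain ⟨k, h1, -, h2⟩ := hk t
  have h3 := h1 y
  rw [dist_comm] at h3
  linarith [h1 x, h2 x y hxy, dist_triangle4 (t • x) (k • x) (k • y) (t • y)]

theorem UniformlyAlmostPeriodic.actsBySurjections (h : UniformlyAlmostPeriodic T X) :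
    ActsBySurjections T X := by
  intro t
  have hcl : IsClosed (Set.range fun x : X => t • x) :=
    (isCompact_range (continuous_const_smul t)).isClosed
  rw [← Set.range_eq_univ, ← hcl.closure_eq, Set.eq_univ_iff_forall]
  intro x
  rw [Metric.mem_closure_range_iff]
  intro ε hε
  obtain ⟨δ, -, hk⟩ := h.exists_approximation hε
  obtain ⟨k, -, ⟨s, hs⟩, -⟩ := hk t
  exact ⟨s • x, by rw [dist_comm]; exact hs x⟩

/-! ### Equicontinuous semiflows -/

theorem Equicontinuous.isCompact_closure (h : Equicontinuous T X) :
    IsCompact (closure (Set.range (smulMap (T := T) X))) := by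
  rw [equicontinuous_iff_dist] at h
  refine isCompact_closure_of_equicontinuous _ fun ε hε => ?_
  obtain ⟨δ, hδ, h⟩ := h ε hε
  refine ⟨δ, hδ, fun x y hxy => ?_⟩
  rintro _ ⟨t, rfl⟩
  exact h x y hxy t

/-- By compactness two distinct powers of `t` are uniformly close. Surjectivity of the smaller one
cancels it, so a positive power of `t` moves every point by less than `ε / 2`, and points identified
by `t` are within `ε`. -/
theorem Equicontinuous.injective (h : Equicontinuous T X) (hs : ActsBySurjections T X) (t : T) :
    Function.Injective fun x : X => t • x := by
  intro x y hxy
  refine eq_of_forall_dist_le fun ε hε => ?_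
  obtain ⟨f, -, φ, hφ, hlim⟩ := h.isCompact_closure.tendsto_subseq
    (x := fun n : ℕ => smulMap X (t ^ n)) fun n => subset_closure ⟨_, rfl⟩
  obtain ⟨N, hN⟩ := Metric.cauchySeq_iff.1 hlim.cauchySeq (ε / 2) (by positivity)
  have hlt : φ N < φ (N + 1) := hφ (Nat.lt_succ_self N)
  have hd := hN (N + 1) (by omega) N le_rfl
  have hret : ∀ z : X, dist (t ^ (φ (N + 1) - φ N) • z) z < ε / 2 := by
    intro z
    obtain ⟨w, rfl⟩ := hs (t ^ φ N) z
    have := (ContinuousMap.dist_apply_le_dist w).trans_lt hd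
    change dist (t ^ φ (N + 1) • w) (t ^ φ N • w) < ε / 2 at this
    change dist (t ^ (φ (N + 1) - φ N) • t ^ φ N • w) (t ^ φ N • w) < ε / 2
    rwa [← mul_smul, ← pow_add, Nat.sub_add_cancel hlt.le]
  obtain ⟨m, hm⟩ : ∃ m, φ (N + 1) - φ N = m + 1 := ⟨φ (N + 1) - φ N - 1, by omega⟩
  have hx := hret x
  have hy := hret y
  have hxy' : t • x = t • y := hxy
  rw [hm, pow_succ, mul_smul] at hx hy
  rw [hxy', dist_comm] at hx
  linarith [dist_triangle x (t ^ m • t • y) y]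

theorem Equicontinuous.actsByHomeomorphisms (h : Equicontinuous T X)
    (hs : ActsBySurjections T X) : ActsByHomeomorphisms T X := fun t =>
  isHomeomorph_iff_continuous_bijective.2 ⟨continuous_const_smul t, h.injective hs t, hs t⟩

theorem Equicontinuous.autEquicontinuous (hpt : PointTransitive T X) (h : Equicontinuous T X) :
    AutEquicontinuous T X := by
  obtain ⟨z, hz⟩ := hpt
  have hdense : Dense (MulAction.orbit T z) := dense_iff_closure_eq.2 hz
  rw [autEquicontinuous_iff_dist]
  intro ε hε
  set E := closure (Set.range (smulMap (T := T) X)) with hE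
  have hEc : IsCompact E := h.isCompact_closure
  have hcomm : ∀ f ∈ E, ∀ a ∈ Aut T X, ∀ x : X, f (a x) = a (f x) := by
    intro f hf a ha x
    have hcl : IsClosed {f : C(X, X) | f (a x) = a (f x)} :=
      isClosed_eq (by fun_prop) (a.continuous.comp (by fun_prop))
    refine closure_minimal ?_ hcl hf
    rintro _ ⟨t, rfl⟩
    exact (ha t x).symm
  let W : Set X := closure {w | ∃ a ∈ Aut T X, a z = w}
  -- The bad triples: `f` and `g` separate a limit `w` of automorphic images of `z`. If `f z = g z`,
  -- then `f` and `g` agree on all these images, hence at `w`; so `dist (f z) (g z)` has a positive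
  -- lower bound on `K`.
  let K : Set (C(X, X) × C(X, X) × X) :=
    (E ×ˢ E ×ˢ W) ∩ {p | ε / 2 ≤ dist (p.1 p.2.2) (p.2.1 p.2.2)}
  have hK : IsCompact K := by
    have hd : Continuous fun p : C(X, X) × C(X, X) × X => dist (p.1 p.2.2) (p.2.1 p.2.2) := by
      fun_prop
    exact (hEc.prod (hEc.prod isClosed_closure.isCompact)).inter_right
      (isClosed_le continuous_const hd)
  have hpos : ∀ p ∈ K, 0 < dist (p.1 z) (p.2.1 z) := by
    rintro ⟨f, g, w⟩ ⟨⟨hf, hg, hw⟩, hd⟩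
    rw [dist_pos]
    intro heq
    have hcl : IsClosed {w | f w = g w} := isClosed_eq f.continuous g.continuous
    have hfg : f w = g w := by
      refine closure_minimal ?_ hcl hw
      rintro _ ⟨a, ha, rfl⟩
      change f (a z) = g (a z)
      rw [hcomm f hf a ha, hcomm g hg a ha]
      exact congrArg a heq
    have hd' : ε / 2 ≤ dist (f w) (g w) := hd
    rw [hfg, dist_self] at hd'
    linarith
  obtain ⟨δ, hδ, hmin⟩ := hK.exists_forall_le' (f := fun p => dist (p.1 z) (p.2.1 z))
    (Continuous.continuousOn (by fun_prop)) hpos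
  refine ⟨δ, hδ, fun x y hxy a ha => ?_⟩
  by_contra! hcon
  -- Relaxing `ε` to the strict bound `ε / 2` gives an open condition, so `x` and `y` may be
  -- replaced by orbit points `s • z` and `r • z`, where `a` can be moved past `s` and `r`.
  have hopen : IsOpen {q : X × X | dist q.1 q.2 < δ ∧ ε / 2 < dist (a q.1) (a q.2)} := by
    exact (isOpen_lt continuous_dist continuous_const).inter (isOpen_lt continuous_const
      ((a.continuous.comp continuous_fst).dist (a.continuous.comp continuous_snd)))
  obtain ⟨⟨_, _⟩, ⟨hq1, hq2⟩, ⟨s, rfl⟩, ⟨r, rfl⟩⟩ :=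
    (hdense.prod hdense).inter_open_nonempty _ hopen ⟨(x, y), hxy, by linarith⟩
  simp only [ha s z, ha r z] at hq1 hq2
  have := hmin (smulMap X s, smulMap X r, a z)
    ⟨⟨subset_closure ⟨s, rfl⟩, subset_closure ⟨r, rfl⟩, subset_closure ⟨a, ha, rfl⟩⟩, hq2.le⟩
  exact absurd hq1 (not_lt.2 this)

/-! ### From equicontinuous automorphisms to transitivity -/

theorem AutEquicontinuous.universallyTransitive (hcomm : ∀ s t : T, s * t = t * s)
    (hpt : PointTransitive T X) (h : AutEquicontinuous T X) (hh : ActsByHomeomorphisms T X) :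
    UniversallyTransitive T X := by
  obtain ⟨z, hz⟩ := hpt
  refine ⟨z, ?_⟩
  rw [autEquicontinuous_iff_dist] at h
  let S : Set C(X, X) := {f | ∃ a ∈ Aut T X, ⇑f = a}
  have hS : IsCompact (closure S) := by
    refine isCompact_closure_of_equicontinuous _ fun ε hε => ?_
    obtain ⟨δ, hδ, h⟩ := h ε hε
    refine ⟨δ, hδ, fun x y hxy => ?_⟩
    rintro f ⟨a, ha, hf⟩
    rw [hf]
    exact h x y hxy a ha
  -- Each map is carried along with its inverse, so that limits remain invertible.
  let K : Set (C(X, X) × C(X, X)) := (closure S ×ˢ closure S) ∩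
    {p | (∀ x, p.1 (p.2 x) = x) ∧ (∀ x, p.2 (p.1 x) = x) ∧ p.1 ∈ commutingMaps T X}
  have hK : IsCompact K := by
    refine (hS.prod hS).inter_right ?_
    refine IsClosed.inter ?_ (IsClosed.inter ?_ (isClosed_commutingMaps.preimage continuous_fst))
    · have h := isClosed_iInter fun x : X => isClosed_eq
        (f := fun p : C(X, X) × C(X, X) => p.1 (p.2 x)) (by fun_prop) (continuous_const (y := x))
      rwa [← Set.ofPred_forall] at h
    · have h := isClosed_iInter fun x : X => isClosed_eq
        (f := fun p : C(X, X) × C(X, X) => p.2 (p.1 x)) (by fun_prop) (continuous_const (y := x))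
      rwa [← Set.ofPred_forall] at h
  have hcl : IsClosed ((fun p : C(X, X) × C(X, X) => p.1 z) '' K) :=
    (hK.image (by fun_prop)).isClosed
  have huniv : (fun p : C(X, X) × C(X, X) => p.1 z) '' K = Set.univ := by
    rw [← Set.univ_subset_iff, ← hz]
    refine closure_minimal ?_ hcl
    rintro _ ⟨t, rfl⟩
    let a : X ≃ₜ X := (hh t).homeomorph
    have ha : a ∈ Aut T X := fun s x => by
      change t • s • x = s • t • x
      rw [← mul_smul, ← mul_smul, hcomm]
    refine ⟨(⟨a, a.continuous⟩, ⟨a.symm, a.symm.continuous⟩),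
      ⟨⟨subset_closure ⟨a, ha, rfl⟩, subset_closure ⟨a⁻¹, inv_mem ha, rfl⟩⟩, ?_, ?_, ha⟩, rfl⟩
    · exact a.apply_symm_apply
    · exact a.symm_apply_apply
  intro y
  obtain ⟨⟨f, g⟩, ⟨-, hfg, hgf, hf⟩, hy⟩ := huniv.symm ▸ Set.mem_univ y
  exact ⟨⟨⟨f, g, hgf, hfg⟩, f.continuous, g.continuous⟩, hf, hy⟩

/-! ### Universal transitivity and the open mapping argument -/

/-- If automorphisms `φ y` map a point `z` with dense orbit to any given `y`, then `φ y` is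
uniformly close to the identity for `y` close to `z`. -/
theorem exists_dist_lt_of_transitive {z : X} (hz : Dense (MulAction.orbit T z)) (φ : X → X ≃ₜ X)
    (hφ : ∀ y, φ y ∈ Aut T X) (hφz : ∀ y, φ y z = y) {ε : ℝ} (hε : 0 < ε) :
    ∀ᶠ y in 𝓝 z, ∀ v, dist (φ y v) v < ε := by
  obtain ⟨η, hη, rfl⟩ : ∃ η > 0, ε = 5 * η := ⟨ε / 5, by positivity, by ring⟩
  have hcomp : ∀ a ∈ Aut T X, ∀ y v, φ (a y) v = a (φ y v) := by
    intro a ha y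
    refine congrFun (eq_of_commuting hz (φ _).continuous (a.continuous.comp (φ y).continuous)
      (hφ _) (mul_mem ha (hφ y)) ?_)
    exact (hφz _).trans (congrArg a (hφz y).symm)
  let E := commutingMaps T X
  have hEφ : ∀ f ∈ E, ⇑f = φ (f z) := fun f hf =>
    eq_of_commuting hz f.continuous (φ _).continuous hf (hφ _) (hφz _).symm
  have : CompleteSpace E := isClosed_commutingMaps.completeSpace_coe
  have : PolishSpace E := inferInstance
  let ev : E → X := fun f => f.1 z
  have hev : Continuous ev := by fun_prop
  have hinj : Function.Injective ev := by
    intro f g hfg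
    refine Subtype.ext (DFunLike.coe_injective ?_)
    rw [hEφ f f.2, hEφ g g.2]
    exact congrArg (fun y => ⇑(φ y)) hfg
  let Φ : X → E := fun y => ⟨⟨φ y, (φ y).continuous⟩, hφ y⟩
  let id' : C(X, X) := ContinuousMap.id X
  let V : Set E := {f | dist f.1 id' < η}
  have hV : IsOpen V := isOpen_lt (by fun_prop) continuous_const
  let A : Set X := ev '' V
  have hAdist : ∀ y ∈ A, ∀ v, dist (φ y v) v < η := by
    rintro _ ⟨f, hf, rfl⟩ v
    have := (ContinuousMap.dist_apply_le_dist v).trans_lt hf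
    rw [hEφ f f.2] at this
    exact this
  -- Lusin–Souslin: an injective continuous image of a Borel subset of a Polish space is Borel,
  -- hence has the Baire property.
  have hAmeas : ∃ O : Set X, IsOpen O ∧ A =ᵇ O := by
    borelize (E : Type _)
    borelize X
    exact ((hev.measurableEmbedding hinj).measurableSet_image.2 hV.measurableSet).residualEq_isOpen
  have hne : Nonempty X := ⟨z⟩
  have hAnm : ¬ IsMeagre A := by
    intro hA
    -- Left translates of `V`. Countably many cover the second countable space `E`, so countably
    -- many homeomorphic copies of `A` cover `X`; Baire then forbids `A` to be meagre.
    let U : E → Set E := fun g =>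
      {f | dist ((⟨(φ (ev g)).symm, (φ (ev g)).symm.continuous⟩ : C(X, X)).comp f.1) id' < η}
    have hU : ∀ g, U g ∈ 𝓝 g := by
      intro g
      have hopen : IsOpen (U g) := by
        refine isOpen_lt (Continuous.dist ?_ continuous_const) continuous_const
        exact (ContinuousMap.continuous_postcomp _).comp continuous_subtype_val
      refine hopen.mem_nhds ?_
      change dist _ _ < η
      rw [show (⟨(φ (ev g)).symm, (φ (ev g)).symm.continuous⟩ : C(X, X)).comp g.1 = id' from ?_,
        dist_self]
      · exact hη
      · ext v
        change (φ (ev g)).symm (g.1 v) = v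
        rw [hEφ g g.2]
        exact (φ (ev g)).symm_apply_apply v
    obtain ⟨s, hs, hsU⟩ := TopologicalSpace.countable_cover_nhds hU
    have hm : IsMeagre (⋃ g ∈ s, (φ (ev g)).symm ⁻¹' A) :=
      isMeagre_biUnion hs fun g _ => hA.preimage_of_isOpenMap (φ (ev g)).symm.continuous
        (φ (ev g)).symm.isOpenMap
    refine not_isMeagre_of_isOpen isOpen_univ Set.univ_nonempty (hm.mono fun y _ => ?_)
    have hy : Φ y ∈ ⋃ g ∈ s, U g := hsU ▸ Set.mem_univ _
    simp only [Set.mem_iUnion] at hy ⊢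
    obtain ⟨g, hg, hy⟩ := hy
    refine ⟨g, hg, ⟨⟨(⟨(φ (ev g)).symm, (φ (ev g)).symm.continuous⟩ : C(X, X)).comp (Φ y).1, ?_⟩,
      hy, ?_⟩⟩
    · exact mul_mem (inv_mem (hφ (ev g))) (hφ y)
    · change (φ (ev g)).symm (φ y z) = _
      rw [hφz]
  obtain ⟨O, hO, hAO⟩ := hAmeas
  have hOne : (A ∩ O).Nonempty := by
    by_contra hcon
    rw [Set.not_nonempty_iff_eq_empty] at hcon
    refine hAnm ?_
    change Aᶜ ∈ residual X
    filter_upwards [hAO.mem_iff] with x hx hxA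
    have : x ∈ A ∩ O := ⟨hxA, hx.1 hxA⟩
    rw [hcon] at this
    exact this
  -- A Pettis-type argument. The automorphism `ψ` taking `y` to `w` makes `O ∩ ψ ⁻¹' O` nonempty, so
  -- some `u` has `u` and `ψ u` both in `A`. Since `φ (ψ u) = ψ ∘ φ u`, `ψ` is within `2 * η` of the
  -- identity.
  have hosc : ∀ y ∈ O, ∀ w ∈ O, ∀ v, dist (φ w v) (φ y v) < 2 * η := by
    intro y hy w hw
    let ψ : X ≃ₜ X := φ w * (φ y)⁻¹
    have hψT : ψ ∈ Aut T X := mul_mem (hφ w) (inv_mem (hφ y))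
    have hψ : ∀ v, ψ (φ y v) = φ w v := fun v => congrArg (φ w) ((φ y).symm_apply_apply v)
    have hψy : ψ y = w := by
      have := hψ z
      rwa [hφz, hφz] at this
    have hAψ : ψ ⁻¹' A =ᵇ ψ ⁻¹' O :=
      hAO.filter_mono (tendsto_residual_of_isOpenMap ψ.continuous ψ.isOpenMap)
    have hnm := not_isMeagre_of_isOpen (hO.inter (hO.preimage ψ.continuous))
      ⟨y, hy, by change ψ y ∈ O; rwa [hψy]⟩
    obtain ⟨u, huA, huψ⟩ : (A ∩ ψ ⁻¹' A).Nonempty := by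
      by_contra hcon
      rw [Set.not_nonempty_iff_eq_empty] at hcon
      refine hnm ?_
      change (O ∩ ψ ⁻¹' O)ᶜ ∈ residual X
      filter_upwards [hAO.mem_iff, hAψ.mem_iff] with x hx hx' hxO
      have : x ∈ A ∩ ψ ⁻¹' A := ⟨hx.2 hxO.1, hx'.2 hxO.2⟩
      rw [hcon] at this
      exact this
    have hψd : ∀ v, dist (ψ v) v < 2 * η := by
      intro v
      obtain ⟨v, rfl⟩ := (φ u).surjective v
      have h1 := hAdist _ huψ v
      rw [hcomp ψ hψT] at h1
      have h2 := hAdist u huA v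
      rw [dist_comm] at h2
      linarith [dist_triangle (ψ (φ u v)) v (φ u v)]
    intro v
    rw [← hψ v]
    exact hψd _
  obtain ⟨y₀, hy₀A, hy₀O⟩ := hOne
  -- Continuity at `y₀` is transported to `z` by `φ y₀`, which is itself within `η` of the identity.
  have hnear : ∀ᶠ y in 𝓝 z, φ y₀ y ∈ O :=
    (φ y₀).continuous.continuousAt.eventually_mem (hO.mem_nhds (by rwa [hφz]))
  filter_upwards [hnear] with y hy v
  have h1 := hosc y₀ hy₀O _ hy v
  rw [hcomp _ (hφ y₀)] at h1
  have h2 := hAdist y₀ hy₀A (φ y v)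
  rw [dist_comm] at h2
  have h3 := hAdist y₀ hy₀A v
  linarith [dist_triangle4 (φ y v) (φ y₀ (φ y v)) (φ y₀ v) v]

/-- The map `(y, v) ↦ φ y v` is jointly continuous, hence uniformly continuous on the compact `X ×
X`, and every automorphism is some `φ y`. -/
theorem UniversallyTransitive.autEquicontinuous (hpt : PointTransitive T X)
    (h : UniversallyTransitive T X) : AutEquicontinuous T X := by
  obtain ⟨z, φ, hz, hφ, hφz⟩ := h.exists_family hpt
  have huniq : ∀ a ∈ Aut T X, ⇑a = φ (a z) := fun a ha =>
    eq_of_commuting hz a.continuous (φ _).continuous ha (hφ _) (hφz _).symm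
  have hcont : Continuous fun p : X × X => φ p.1 p.2 := by
    have hbase : ∀ u, Tendsto (fun p : X × X => φ p.1 p.2) (𝓝 (z, u)) (𝓝 u) := by
      intro u
      rw [Metric.tendsto_nhds]
      intro ε hε
      have h1 := exists_dist_lt_of_transitive hz φ hφ hφz (half_pos hε)
      have h2 : ∀ᶠ v in 𝓝 u, dist v u < ε / 2 := Metric.ball_mem_nhds u (half_pos hε)
      rw [nhds_prod_eq]
      filter_upwards [h1.prod_mk h2] with p hp
      linarith [hp.1 p.2, hp.2, dist_triangle (φ p.1 p.2) p.2 u]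
    rw [continuous_iff_continuousAt]
    rintro ⟨y, u⟩
    -- By uniqueness `φ p.1 = φ y ∘ φ ((φ y).symm p.1)`, which reduces continuity at `y` to
    -- continuity at `z`.
    have hfac : (fun p : X × X => φ p.1 p.2) =
        φ y ∘ (fun p : X × X => φ p.1 p.2) ∘ fun p : X × X => ((φ y).symm p.1, p.2) := by
      funext p
      have := huniq (φ y * φ ((φ y).symm p.1)) (mul_mem (hφ _) (hφ _))
      have hpz : (φ y * φ ((φ y).symm p.1)) z = p.1 := by
        change φ y (φ ((φ y).symm p.1) z) = p.1
        rw [hφz, (φ y).apply_symm_apply]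
      rw [hpz] at this
      exact (congrFun this p.2).symm
    have hyz : (φ y).symm y = z := (φ y).symm_apply_eq.2 (hφz y).symm
    have hpair : Continuous fun p : X × X => ((φ y).symm p.1, p.2) := by
      have := (φ y).symm.continuous
      fun_prop
    have hlim := hpair.tendsto (y, u)
    rw [hyz] at hlim
    have key := ((φ y).continuous.tendsto u).comp ((hbase u).comp hlim)
    rw [← hfac] at key
    exact key
  have huc := CompactSpace.uniformContinuous_of_continuous hcont
  rw [autEquicontinuous_iff_dist]
  intro ε hε
  obtain ⟨δ, hδ, hd⟩ := Metric.uniformContinuous_iff.1 huc ε hε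
  refine ⟨δ, hδ, fun x y hxy a ha => ?_⟩
  rw [huniq a ha]
  refine hd (a := (a z, x)) (b := (a z, y)) ?_
  rw [Prod.dist_eq, dist_self]
  exact max_lt hδ hxy

theorem UniversallyTransitive.uniformlyAlmostPeriodic (hpt : PointTransitive T X)
    (h : UniversallyTransitive T X) : UniformlyAlmostPeriodic T X := by
  have heq := autEquicontinuous_iff_dist.1 (h.autEquicontinuous hpt)
  obtain ⟨z, φ, hz, hφ, hφz⟩ := h.exists_family hpt
  rw [uniformlyAlmostPeriodic_iff_dist]
  intro ε hε
  obtain ⟨δ, hδ, hd⟩ := heq ε hε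
  refine ⟨{t | dist z (t • z) < δ}, ?_, fun t ht x => ?_⟩
  -- Every orbit is dense, being the image of the orbit of `z` under `φ y`. A finite subcover
  -- supplies the compact set for syndeticity.
  · have hcover : ∀ y : X, ∃ t : T, dist z (t • y) < δ := by
      intro y
      obtain ⟨_, hx, t, rfl⟩ := hz.inter_open_nonempty ((φ y) ⁻¹' Metric.ball z δ)
        (Metric.isOpen_ball.preimage (φ y).continuous)
        ⟨(φ y).symm z, by simpa using hδ⟩
      refine ⟨t, ?_⟩
      have hx' : dist (φ y (t • z)) z < δ := hx
      rwa [hφ y t z, hφz, dist_comm] at hx'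
    obtain ⟨F, hF⟩ := isCompact_univ.elim_finite_subcover
      (fun t : T => {y : X | dist z (t • y) < δ})
      (fun t => isOpen_lt (continuous_const.dist (continuous_const_smul t)) continuous_const)
      (fun y _ => Set.mem_iUnion.2 (hcover y))
    refine ⟨F, F.finite_toSet.isCompact, fun t => ?_⟩
    have := hF (Set.mem_univ (t • z))
    simp only [Set.mem_iUnion] at this
    obtain ⟨k, hk, hkt⟩ := this
    refine ⟨k, hk, ?_⟩
    change dist z ((k * t) • z) < δ
    rw [mul_smul]
    exact hkt
  -- The automorphism `φ x` takes the pair `z`, `t • z` to `x`, `t • x`.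
  · have := hd _ _ ht (φ x) (hφ x)
    rwa [hφ x t z, hφz] at this

end Compact

/-! ### The noncommutative counterexample -/

theorem autEquicontinuous_of_discreteTopology (T : Type*) {X : Type*} [Monoid T] [UniformSpace X]
    [CompactSpace X] [DiscreteTopology X] [MulAction T X] : AutEquicontinuous T X := by
  intro ε hε
  have hd : Set.diagonal X ∈ 𝓤 X := by
    rw [← nhdsSet_diagonal_eq_uniformity]
    exact (isOpen_discrete _).mem_nhdsSet.2 subset_rfl
  refine ⟨_, hd, fun x y hxy a _ => ?_⟩
  obtain rfl : x = y := hxy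
  exact mem_uniformity_of_eq hε rfl

/-- The permutation action on three points has trivial automorphism group. -/
theorem not_universallyTransitive_perm [TopologicalSpace (Fin 3)] :
    ¬ UniversallyTransitive (Equiv.Perm (Fin 3)) (Fin 3) := by
  rintro ⟨x, hx⟩
  obtain ⟨y, w, hxy, hxw, hyw⟩ : ∃ y w : Fin 3, x ≠ y ∧ x ≠ w ∧ y ≠ w := by
    clear hx
    revert x
    decide
  obtain ⟨a, ha, hax⟩ := hx y
  -- The swap fixes `x` but moves `y = a x`, so `a` cannot commute with it.
  have h := ha (Equiv.swap y w) x
  simp only [Equiv.Perm.smul_def] at h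
  rw [Equiv.swap_apply_of_ne_of_ne hxy hxw, hax, Equiv.swap_apply_left] at h
  exact hyw h

end Semiflow

theorem mainTheorem9 :
    (∀ (T : Type*) (X : Type*) [Monoid T] [TopologicalSpace T] [ContinuousMul T]
        [MetricSpace X] [CompactSpace X] [MulAction T X] [ContinuousSMul T X],
      Semiflow.PointTransitive T X →
        -- for commutative `T` the four properties are equivalent
        ((∀ s t : T, s * t = t * s) →
          List.TFAE [
            Semiflow.UniversallyTransitive T X,
            Semiflow.AutEquicontinuous T X ∧ Semiflow.ActsByHomeomorphisms T X,
            Semiflow.Equicontinuous T X ∧ Semiflow.ActsBySurjections T X,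
            Semiflow.UniformlyAlmostPeriodic T X]) ∧
        -- (1) → (4) → (3) → (2) hold without commutativity of `T`
        (Semiflow.UniversallyTransitive T X → Semiflow.UniformlyAlmostPeriodic T X) ∧
        (Semiflow.UniformlyAlmostPeriodic T X →
          Semiflow.Equicontinuous T X ∧ Semiflow.ActsBySurjections T X) ∧
        (Semiflow.Equicontinuous T X ∧ Semiflow.ActsBySurjections T X →
          Semiflow.AutEquicontinuous T X ∧ Semiflow.ActsByHomeomorphisms T X)) ∧
    -- (2) → (1) fails in general without commutativity of `T`
    (∃ (T : Type) (X : Type) (_ : Monoid T) (_ : TopologicalSpace T) (_ : ContinuousMul T)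
        (_ : MetricSpace X) (_ : CompactSpace X) (_ : MulAction T X) (_ : ContinuousSMul T X),
      Semiflow.PointTransitive T X ∧
        (Semiflow.AutEquicontinuous T X ∧ Semiflow.ActsByHomeomorphisms T X) ∧
        ¬ Semiflow.UniversallyTransitive T X) := by 
  refine ⟨fun T X _ _ _ _ _ _ _ hpt => ?_, ?_⟩
  · have h14 : Semiflow.UniversallyTransitive T X → Semiflow.UniformlyAlmostPeriodic T X :=
      fun h => h.uniformlyAlmostPeriodic hpt
    have h43 : Semiflow.UniformlyAlmostPeriodic T X →
        Semiflow.Equicontinuous T X ∧ Semiflow.ActsBySurjections T X :=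
      fun h => ⟨h.equicontinuous, h.actsBySurjections⟩
    have h32 : Semiflow.Equicontinuous T X ∧ Semiflow.ActsBySurjections T X →
        Semiflow.AutEquicontinuous T X ∧ Semiflow.ActsByHomeomorphisms T X :=
      fun h => ⟨h.1.autEquicontinuous hpt, h.1.actsByHomeomorphisms h.2⟩
    refine ⟨fun hcomm => ?_, h14, h43, h32⟩
    tfae_have 1 → 4 := h14
    tfae_have 4 → 3 := h43
    tfae_have 3 → 2 := h32
    tfae_have 2 → 1 := fun h => h.1.universallyTransitive hcomm hpt h.2
    tfae_finish
  · let _ : TopologicalSpace (Equiv.Perm (Fin 3)) := ⊥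
    have : DiscreteTopology (Equiv.Perm (Fin 3)) := ⟨rfl⟩
    let _ : MetricSpace (Fin 3) := TopologicalSpace.metrizableSpaceMetric (Fin 3)
    have : ContinuousSMul (Equiv.Perm (Fin 3)) (Fin 3) :=
      ⟨continuous_of_discreteTopology⟩
    refine ⟨Equiv.Perm (Fin 3), Fin 3, inferInstance, inferInstance, inferInstance, inferInstance,
      inferInstance, inferInstance, inferInstance, ⟨0, ?_⟩, ⟨?_, fun t => ?_⟩,
      Semiflow.not_universallyTransitive_perm⟩
    · rw [MulAction.orbit_eq_univ, closure_univ]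
    · exact Semiflow.autEquicontinuous_of_discreteTopology _
    · exact isHomeomorph_iff_continuous_bijective.2
        ⟨continuous_of_discreteTopology, MulAction.bijective t⟩
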